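/- Let $0<\lambda_{\min}\le\lambda_{\max}$. There is a constant $C>0$, depending only on $\lambda_{\min}$ and $\lambda_{\max}$, such that the following holds for every $n$, every Hermitian positive definite $A\in\mathbb{C}^{n\times n}$ with smallest eigenvalue $\lambda_{\min}$ and largest eigenvalue $\lambda_{\max}$, and every Stieltjes function $$f(x)=\int_0^\infty (x+t)^{-1}\,d\mu(t),\qquad f(M)=\int_0^\infty (M+tI)^{-1}\,d\mu(t)\ \text{ for square matrices } M,$$ where $\mu$ is a nonnegative, monotonically increasing function on $[0,\infty)$ with $\int_0^\infty \frac{1}{1+t}\,d\mu(t)<\infty$. The matrix function $f$ is Fréchet differentiable at $A$; let $L_f(A,\cdot)$ be its Fréchet derivative there. Let $\eta\in\mathbb{C}$, let $y,z\in\mathbb{C}^n$ with $\|y\|=\|z\|=1$, and let $m\ge 1$. Let $\mathcal{Q}_m(A,y)=q_{m-1}(A)^{-1}\,\mathrm{span}\{y,Ay,\dots,A^{m-1}y\}$ with $q_{m-1}(x)=\prod_{j=1}^{m-1}(x-\xi_j)$ be the rational Krylov subspace with poles $\xi_{2i-1}=\infty$, $\xi_{2i}=0$ (extended Krylov; the factor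 of an infinite pole is $1$). Let the columns of $V$ and $W$ be orthonormal bases of $\mathcal{Q}_m(A,y)$ and $\mathcal{Q}_m(A,z)$, and let $L_m^{\mathrm{Rat}}=VX_mW^H$, where $X_m$ is the $(1,2)$ block of $$f\!\left(\begin{bmatrix}V^HAV & \eta\,(V^Hy)(W^Hz)^H\\ 0& W^HAW\end{bmatrix}\right).$$ (If the first columns of $V$ and $W$ are $y$ and $z$, the off-diagonal block is $\eta e_1e_1^H$.) Then $$\|L_f(A,\eta yz^H)-L_m^{\mathrm{Rat}}\|\le |\eta|\,f(\lambda_{\min})\,C\left(\frac{\sqrt[4]{\kappa}-1}{\sqrt[4]{\kappa}+1}\right)^m,$$ where $\|\cdot\|$ is the Euclidean vector norm and the matrix two-norm, and $\kappa=\|A\|\,\|A^{-1}\|$. -/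

import Mathlib

open Matrix MeasureTheory
open scoped NNReal Matrix.Norms.L2Operator ComplexOrder

noncomputable section

/-- The Lebesgue–Stieltjes measure `dμ` on `[0, ∞)` of an increasing function `μ` on `[0, ∞)`.
The function is extended to the left of `0` by the constant `μ 0`, so the measure lives on
`[0, ∞)` and its mass at `0` is the jump `μ (0+) - μ 0`, as for the Riemann–Stieltjes
integral over `[0, ∞)`. -/
def stieltjesMeasure (μ : ℝ≥0 → ℝ) (hμ : Monotone μ) : Measure ℝ :=
  (hμ.comp (fun _ _ h => Real.toNNReal_mono h : Monotone Real.toNNReal)).stieltjesFunction.measure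

/-- The scalar Stieltjes function `f(x) = ∫_0^∞ (x + t)⁻¹ dν(t)`. -/
def stieltjesFun (ν : Measure ℝ) (x : ℝ) : ℝ :=
  ∫ t in Set.Ici (0 : ℝ), (x + t)⁻¹ ∂ν

/-- The matrix Stieltjes function `f(A) = ∫_0^∞ (A + t I)⁻¹ dν(t)`. -/
def stieltjesMatrixFun {ι : Type*} [Fintype ι] [DecidableEq ι] (ν : Measure ℝ)
    (A : Matrix ι ι ℂ) : Matrix ι ι ℂ :=
  ∫ t in Set.Ici (0 : ℝ), (A + (t : ℂ) • (1 : Matrix ι ι ℂ))⁻¹ ∂ν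

/-- The Fréchet derivative `L_f(A, E)` of the matrix Stieltjes function at `A` in direction `E`
(with respect to the matrix two-norm). -/
def stieltjesFrechet {ι : Type*} [Fintype ι] [DecidableEq ι] (ν : Measure ℝ)
    (A E : Matrix ι ι ℂ) : Matrix ι ι ℂ :=
  fderiv ℂ (stieltjesMatrixFun (ι := ι) ν) A E

/-- The condition number `‖A‖ ‖A⁻¹‖` in the matrix two-norm. -/
def condNumber {ι : Type*} [Fintype ι] [DecidableEq ι] (A : Matrix ι ι ℂ) : ℝ :=
  ‖A‖ * ‖A⁻¹‖

/-- The factor of the denominator polynomial belonging to one pole `ξ ∈ ℂ ∪ {∞}`: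
`z - ξ` for a finite pole and `1` for the pole `∞`. -/
def poleFactor : OnePoint ℂ → Polynomial ℂ
  | none => 1
  | some c => Polynomial.X - Polynomial.C c

/-- The denominator polynomial `q_{m-1}(z) = (z - ξ₁) ⋯ (z - ξ_{m-1})`. -/
def denomPoly (ξ : ℕ → OnePoint ℂ) (m : ℕ) : Polynomial ℂ :=
  ∏ j ∈ Finset.Icc 1 (m - 1), poleFactor (ξ j)

/-- The polynomial Krylov subspace `K_m(A, y) = span {y, A y, …, A^{m-1} y}`. -/
def krylov {n : ℕ} (A : Matrix (Fin n) (Fin n) ℂ) (y : Fin n → ℂ) (m : ℕ) :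
    Submodule ℂ (Fin n → ℂ) :=
  Submodule.span ℂ (Set.range fun i : Fin m => (A ^ (i : ℕ)) *ᵥ y)

/-- The rational Krylov subspace `Q_m(A, y) = q_{m-1}(A)⁻¹ K_m(A, y)` with poles
`ξ₁, …, ξ_{m-1}`. -/
def rationalKrylov {n : ℕ} (A : Matrix (Fin n) (Fin n) ℂ) (y : Fin n → ℂ)
    (ξ : ℕ → OnePoint ℂ) (m : ℕ) : Submodule ℂ (Fin n → ℂ) :=
  (krylov A y m).map (Matrix.toLin' (Polynomial.aeval A (denomPoly ξ m))⁻¹)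

/-- The poles of the extended Krylov method: `ξ_{2i-1} = ∞`, `ξ_{2i} = 0`. -/
def extendedPoles (j : ℕ) : OnePoint ℂ :=
  if Odd j then OnePoint.infty else ((0 : ℂ) : OnePoint ℂ)

/-- The columns of `V` form an orthonormal basis of the subspace `S`. -/
def IsOrthonormalBasisOf {n k : ℕ} (V : Matrix (Fin n) (Fin k) ℂ)
    (S : Submodule ℂ (Fin n → ℂ)) : Prop :=
  Vᴴ * V = 1 ∧ Submodule.span ℂ (Set.range V.col) = S

/-- The Krylov approximation `V X Wᴴ` of `L_f(A, η y zᴴ)` from orthonormal bases `V`, `W`, where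
`X` is the `(1,2)` block of `f(B)` for
`B = [[Vᴴ A V, η (Vᴴ y) (Wᴴ z)ᴴ], [0, Wᴴ A W]]`.
If the first columns of `V`, `W` are `y / ‖y‖`, `z / ‖z‖` then `Vᴴ y = ‖y‖ e₁`,
`Wᴴ z = ‖z‖ e₁`, so the `(1,2)` block of `B` is `η ‖y‖ ‖z‖ e₁ e₁ᴴ`. -/
def krylovFrechetApprox {n k l : ℕ} (ν : Measure ℝ) (A : Matrix (Fin n) (Fin n) ℂ) (η : ℂ)
    (y z : Fin n → ℂ) (V : Matrix (Fin n) (Fin k) ℂ) (W : Matrix (Fin n) (Fin l) ℂ) :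
    Matrix (Fin n) (Fin n) ℂ :=
  V * (stieltjesMatrixFun ν
    (Matrix.fromBlocks (Vᴴ * A * V) (η • vecMulVec (Vᴴ *ᵥ y) (star (Wᴴ *ᵥ z)))
      0 (Wᴴ * A * W))).toBlocks₁₂ * Wᴴ

end

/-! With R = (A + tI)⁻¹, the integral representation gives L_f(A, E) = -∫ R E R dμ(t), and block
triangular inversion turns the Krylov approximation into -∫ G E G' dμ(t), where G and G' are the
Galerkin resolvents of V and W. For E = η y zᴴ the difference of the integrands is controlled by (R
- G)y and (R - G')z, since R and G' are Hermitian. Galerkin is quasi-optimal with a constant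
independent of t (`norm_resolvent_sub_galerkinResolvent_mulVec_le`), so it remains to bound the
distance of Ry from the extended Krylov space. By functional calculus it is at most (a + t)⁻¹ sup |1
- (x + t) p(x)/x^s| over [a, b] = [λmin, λmax], where s = ⌊(m-1)/2⌋ and deg p < m.

The scalar problem is solved in `exists_polynomial_abs_one_sub_le`: u = x + ab/x folds [a, b] onto
[2√(ab), a + b] and sends -t to a point u ≤ -2√(ab). The Chebyshev polynomial T_s transplanted to
that interval and normalised at the image of -t is at most 2ρ^(2s), with ρ = ((b/a)^(1/4) -
1)/((b/a)^(1/4) + 1), uniformly in t. Two factors (a + t)⁻¹ occur under the integral: one is bounded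
by 1/a, the other integrates to f(λmin). -/

/-! ### Scalar rational approximation of the resolvent function -/

open Polynomial in
/-- Clearing denominators in `R (x + c / x)`. -/
lemma exists_polynomial_eval_eq_pow_mul_eval_add_div (R : ℝ[X]) (s : ℕ) (hR : R.natDegree ≤ s)
    (c : ℝ) : ∃ P : ℝ[X], P.natDegree ≤ 2 * s ∧
      ∀ x : ℝ, x ≠ 0 → P.eval x = x ^ s * R.eval (x + c / x) := by
  refine ⟨∑ i ∈ Finset.range (s + 1), C (R.coeff i) * (X ^ 2 + C c) ^ i * X ^ (s - i), ?_, ?_⟩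
  · refine natDegree_sum_le_of_forall_le _ _ fun i hi => ?_
    have hi' : i ≤ s := Nat.lt_succ_iff.mp (Finset.mem_range.mp hi)
    have h1 : ((X ^ 2 + C c : ℝ[X]) ^ i).natDegree ≤ i * 2 :=
      natDegree_pow_le_of_le i (by compute_degree)
    have h2 : (C (R.coeff i) * (X ^ 2 + C c) ^ i).natDegree ≤ i * 2 :=
      (natDegree_C_mul_le _ _).trans h1
    have h3 : (X ^ (s - i) : ℝ[X]).natDegree ≤ s - i := natDegree_X_pow_le _
    have := natDegree_mul_le_of_le h2 h3
    omega
  · intro x hx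
    rw [eval_eq_sum_range' (Nat.lt_succ_of_le hR), Finset.mul_sum, eval_finsetSum]
    refine Finset.sum_congr rfl fun i hi => ?_
    have hi' : i ≤ s := Nat.lt_succ_iff.mp (Finset.mem_range.mp hi)
    have h : x + c / x = (x ^ 2 + c) / x := by field_simp
    rw [h, div_pow, ← Nat.sub_add_cancel hi']
    simp only [eval_mul, eval_C, eval_pow, eval_add, eval_X, Nat.add_sub_cancel, pow_add]
    field_simp

/-- Growth of the Chebyshev polynomials to the right of `1`. -/
lemma inv_pow_le_two_mul_eval_chebyshev_T {r x : ℝ} (hr : 0 < r) (hr1 : r ≤ 1)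
    (hx : (r⁻¹ + r) / 2 ≤ x) (s : ℕ) :
    (r⁻¹) ^ s ≤ 2 * (Polynomial.Chebyshev.T ℝ s).eval x := by
  have hr1' : 1 ≤ r⁻¹ := (one_le_inv₀ hr).mpr hr1
  -- With r = e^(-θ) the threshold is cosh θ, and T_s(cosh φ) = cosh(sφ) ≥ e^(sφ)/2.
  set θ := Real.log r⁻¹ with hθ
  have hexp : Real.exp θ = r⁻¹ := Real.exp_log (by positivity)
  have hcosh : Real.cosh θ = (r⁻¹ + r) / 2 := by
    rw [Real.cosh_eq, Real.exp_neg, hexp, inv_inv]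
  have hθ0 : 0 ≤ θ := Real.log_nonneg hr1'
  have hx1 : 1 ≤ x := le_trans (hcosh ▸ Real.one_le_cosh θ) hx
  have hφ0 : 0 ≤ Real.arcosh x := Real.arcosh_nonneg hx1
  have hle : θ ≤ Real.arcosh x := by
    have : Real.cosh θ ≤ Real.cosh (Real.arcosh x) := by
      rw [Real.cosh_arcosh hx1, hcosh]; exact hx
    rwa [Real.cosh_le_cosh, abs_of_nonneg hθ0, abs_of_nonneg hφ0] at this
  rw [← Real.cosh_arcosh hx1, Polynomial.Chebyshev.T_real_cosh, Real.cosh_eq, ← hexp,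
    ← Real.exp_nat_mul]
  have h1 : Real.exp (s * θ) ≤ Real.exp (((s : ℤ) : ℝ) * Real.arcosh x) := by
    apply Real.exp_le_exp.mpr
    push_cast
    gcongr
  have h2 := Real.exp_pos (-(((s : ℤ) : ℝ) * Real.arcosh x))
  linarith

open Polynomial in
/-- Rational functions with poles `0` and `∞` of order `s` that approximate `(x + t)⁻¹` on
`[a, a q⁴]`. -/
lemma exists_polynomial_abs_one_sub_le {a q t : ℝ} (ha : 0 < a) (hq : 1 < q) (ht : 0 ≤ t) (s : ℕ) :
    ∃ p : ℝ[X], p.natDegree ≤ 2 * s - 1 ∧ (s = 0 → p = 0) ∧ ∀ x ∈ Set.Icc a (a * q ^ 4),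
      |1 - (x + t) * (p.eval x / x ^ s)| ≤ 2 * (((q - 1) / (q + 1)) ^ 2) ^ s := by
  rcases Nat.eq_zero_or_pos s with rfl | hs
  · exact ⟨0, by simp, by simp, fun x _ => by simp⟩
  have hq1 : 0 < q - 1 := by linarith
  -- The substitution x + c/x is singular at -t = 0, but there 1/x = x^(s-1)/x^s is exact.
  rcases ht.eq_or_lt with rfl | ht
  · refine ⟨X ^ (s - 1), ?_, by omega, fun x hx => ?_⟩
    · rw [natDegree_X_pow]; omega
    · have hx0 : 0 < x := ha.trans_le hx.1
      have : (x + 0) * ((X ^ (s - 1) : ℝ[X]).eval x / x ^ s) = 1 := by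
        obtain ⟨k, rfl⟩ : ∃ k, s = k + 1 := ⟨s - 1, by omega⟩
        simp only [eval_pow, eval_X, Nat.add_sub_cancel]
        field_simp
        ring
      rw [this]
      simp only [sub_self, abs_zero]
      positivity
  set d := (q ^ 2 - 1) ^ 2 with hd
  have hd0 : 0 < d := by
    have : 0 < q ^ 2 - 1 := by nlinarith
    positivity
  -- With b = a q⁴, the affine argument maps 2√(ab) = 2aq² to 1 and a + b to -1; it is decreasing,
  -- so points left of the interval land above 1.
  set R : ℝ[X] := (Chebyshev.T ℝ s).comp (C ((q ^ 2 + 1) ^ 2 / d) - C (2 / (a * d)) * X) with hR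
  have hRdeg : R.natDegree ≤ s := by
    have h1 : (C ((q ^ 2 + 1) ^ 2 / d) - C (2 / (a * d)) * X : ℝ[X]).natDegree ≤ 1 := by
      compute_degree
    have h2 : (Chebyshev.T ℝ s).natDegree ≤ s := by
      simp [Chebyshev.natDegree_T]
    calc R.natDegree ≤ _ := natDegree_comp_le
      _ ≤ s * 1 := Nat.mul_le_mul h2 h1
      _ = s := mul_one s
  have hReval (y : ℝ) : R.eval y = (Chebyshev.T ℝ s).eval (((q ^ 2 + 1) ^ 2 - 2 * y / a) / d) := by
    rw [hR, eval_comp]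
    congr 1
    simp
    field_simp
  obtain ⟨P, hPdeg, hP⟩ := exists_polynomial_eval_eq_pow_mul_eval_add_div R s hRdeg (a ^ 2 * q ^ 4)
  set r := ((q - 1) / (q + 1)) ^ 2 with hr
  have hr0 : 0 < r := by positivity
  have hr1 : r ≤ 1 := by
    apply pow_le_one₀ (by positivity)
    rw [div_le_one (by linarith)]
    linarith
  set τ := R.eval (-t + a ^ 2 * q ^ 4 / (-t)) with hτ
  have hgrow : (r⁻¹) ^ s ≤ 2 * τ := by
    rw [hτ, hReval]
    apply inv_pow_le_two_mul_eval_chebyshev_T hr0 hr1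
    have h1 : 2 * (a * q ^ 2) ≤ t + a ^ 2 * q ^ 4 / t := by
      have : t + a ^ 2 * q ^ 4 / t - 2 * (a * q ^ 2) = (t - a * q ^ 2) ^ 2 / t := by
        field_simp
        ring
      have h2 : 0 ≤ (t - a * q ^ 2) ^ 2 / t := by positivity
      linarith
    -- The right side is the affine image of -2aq², the worst case over t > 0, attained at t = aq².
    have h2 : (r⁻¹ + r) / 2 = ((q ^ 2 + 1) ^ 2 + 4 * q ^ 2) / d := by
      rw [hr, hd]
      have : q ^ 2 - 1 = (q - 1) * (q + 1) := by ring
      rw [this]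
      field_simp
      ring
    rw [h2]
    apply div_le_div_of_nonneg_right _ hd0.le
    have h3 : 2 * (-t + a ^ 2 * q ^ 4 / -t) / a ≤ -(4 * q ^ 2) := by
      rw [div_le_iff₀ ha, div_neg]
      linarith
    linarith
  have hτ0 : 0 < τ := by
    have : 0 < (r⁻¹) ^ s := by positivity
    linarith
  -- Normalising by τ makes x^s - P(x)/τ divisible by x + t; the quotient p turns 1 - (x +
  -- t)p(x)/x^s into R(x + ab/x)/τ.
  have hroot : (X ^ s - C (1 / τ) * P).IsRoot (-t) := by
    rw [IsRoot, eval_sub, eval_mul, eval_C, hP _ (by linarith), ← hτ]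
    simp
    field_simp
    ring
  obtain ⟨p, hp⟩ := dvd_iff_isRoot.mpr hroot
  refine ⟨p, ?_, by omega, fun x hx => ?_⟩
  · by_cases hp0 : p = 0
    · simp [hp0]
    have h1 := natDegree_mul (X_sub_C_ne_zero (-t)) hp0
    rw [← hp, natDegree_X_sub_C] at h1
    have h2 : (X ^ s - C (1 / τ) * P).natDegree ≤ 2 * s := by
      refine (natDegree_sub_le _ _).trans (max_le ?_ ((natDegree_C_mul_le _ _).trans hPdeg))
      rw [natDegree_X_pow]
      omega
    omega
  · have hx0 : 0 < x := ha.trans_le hx.1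
    have h1 := congrArg (eval x) hp
    simp only [eval_sub, eval_mul, eval_pow, eval_X, eval_C, sub_neg_eq_add, hP x hx0.ne'] at h1
    have h2 : 1 - (x + t) * (p.eval x / x ^ s) = R.eval (x + a ^ 2 * q ^ 4 / x) / τ := by
      rw [← mul_div_assoc, ← h1]
      field_simp
      ring
    have h3 : |R.eval (x + a ^ 2 * q ^ 4 / x)| ≤ 1 := by
      rw [hReval]
      apply Chebyshev.abs_eval_T_real_le_one
      have h4 : 2 * (a * q ^ 2) ≤ x + a ^ 2 * q ^ 4 / x := by
        have : x + a ^ 2 * q ^ 4 / x - 2 * (a * q ^ 2) = (x - a * q ^ 2) ^ 2 / x := by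
          field_simp
          ring
        have h2 : 0 ≤ (x - a * q ^ 2) ^ 2 / x := by positivity
        linarith
      have h5 : x + a ^ 2 * q ^ 4 / x ≤ a + a * q ^ 4 := by
        have : a + a * q ^ 4 - (x + a ^ 2 * q ^ 4 / x) = (x - a) * (a * q ^ 4 - x) / x := by
          field_simp
          ring
        have h2 : 0 ≤ (x - a) * (a * q ^ 4 - x) / x :=
          div_nonneg (mul_nonneg (by linarith [hx.1]) (by linarith [hx.2])) hx0.le
        linarith
      have h6 : 2 * (x + a ^ 2 * q ^ 4 / x) / a ≤ 2 * (1 + q ^ 4) := by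
        rw [div_le_iff₀ ha]; linarith
      have h7 : 4 * q ^ 2 ≤ 2 * (x + a ^ 2 * q ^ 4 / x) / a := by
        rw [le_div_iff₀ ha]; linarith
      rw [abs_le, le_div_iff₀ hd0, div_le_iff₀ hd0, hd]
      constructor <;> nlinarith
    rw [h2, abs_div, abs_of_pos hτ0, div_le_iff₀ hτ0]
    calc _ ≤ (1 : ℝ) := h3
      _ = r ^ s * (r⁻¹) ^ s := by rw [← mul_pow, mul_inv_cancel₀ hr0.ne', one_pow]
      _ ≤ r ^ s * (2 * τ) := by gcongr
      _ = 2 * r ^ s * τ := by ring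

/-- The convergence factor of the extended Krylov method for the condition number `κ`. -/
noncomputable def extendedRate (κ : ℝ) : ℝ := (κ ^ (1 / 4 : ℝ) - 1) / (κ ^ (1 / 4 : ℝ) + 1)

lemma extendedRate_nonneg {κ : ℝ} (h : 1 ≤ κ) : 0 ≤ extendedRate κ := by
  have : 1 ≤ κ ^ (1 / 4 : ℝ) := Real.one_le_rpow h (by norm_num)
  exact div_nonneg (by linarith) (by linarith)

lemma extendedRate_mono {κ κ' : ℝ} (h : 1 ≤ κ) (h' : κ ≤ κ') :
    extendedRate κ ≤ extendedRate κ' := by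
  have h1 : 1 ≤ κ ^ (1 / 4 : ℝ) := Real.one_le_rpow h (by norm_num)
  have h2 : κ ^ (1 / 4 : ℝ) ≤ κ' ^ (1 / 4 : ℝ) :=
    Real.rpow_le_rpow (by linarith) h' (by norm_num)
  rw [extendedRate, extendedRate, div_le_div_iff₀ (by linarith) (by linarith)]
  nlinarith

open Polynomial in
/-- Uniform approximation of `(x + t)⁻¹` on `[a, b]` from the scalar extended Krylov spaces. -/
lemma exists_extended_approx {a b : ℝ} (ha : 0 < a) (hab : a ≤ b) :
    ∃ K : ℝ, 0 < K ∧ ∀ m : ℕ, 1 ≤ m → ∀ t : ℝ, 0 ≤ t → ∃ p : ℝ[X], p.natDegree < m ∧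
      ∀ x ∈ Set.Icc a b,
        |1 - (x + t) * (p.eval x / x ^ ((m - 1) / 2))| ≤ K * extendedRate (b / a) ^ m := by
  -- If a = b the rate is 0, so the approximation must be exact; a constant p suffices at a single
  -- point.
  rcases hab.eq_or_lt with rfl | hab
  · refine ⟨1, one_pos, fun m hm t ht => ⟨C (a ^ ((m - 1) / 2) / (a + t)), ?_, fun x hx => ?_⟩⟩
    · simpa using Nat.lt_of_succ_le hm
    · obtain rfl : x = a := by simpa using hx
      have : x + t ≠ 0 := by positivity
      have h : 1 - (x + t) * ((C (x ^ ((m - 1) / 2) / (x + t)) : ℝ[X]).eval x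
          / x ^ ((m - 1) / 2)) = 0 := by
        simp only [eval_C]
        field_simp
        ring
      rw [h, abs_zero, one_mul]
      exact pow_nonneg (extendedRate_nonneg (by rw [div_self ha.ne'])) _
  · set q := (b / a) ^ (1 / 4 : ℝ) with hqdef
    have hba : 1 < b / a := (one_lt_div ha).mpr hab
    have hq : 1 < q := Real.one_lt_rpow hba (by norm_num)
    have hb : b = a * q ^ 4 := by
      rw [hqdef, ← Real.rpow_natCast, ← Real.rpow_mul (by positivity)]
      norm_num
      field_simp
    have hρ : extendedRate (b / a) = (q - 1) / (q + 1) := rfl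
    set ρ := (q - 1) / (q + 1) with hρdef
    have hρ0 : 0 < ρ := div_pos (by linarith) (by linarith)
    have hρ1 : ρ ≤ 1 := by
      rw [hρdef, div_le_one (by linarith)]; linarith
    -- The factor ρ⁻² pays for rounding, since 2⌊(m-1)/2⌋ + 2 ≥ m.
    refine ⟨2 / ρ ^ 2, by positivity, fun m hm t ht => ?_⟩
    obtain ⟨p, hdeg, h0, hp⟩ := exists_polynomial_abs_one_sub_le ha hq ht ((m - 1) / 2)
    refine ⟨p, by omega, fun x hx => (hp x (hb ▸ hx)).trans ?_⟩
    rw [hρ, ← hρdef, ← pow_mul, div_mul_eq_mul_div, le_div_iff₀ (by positivity), mul_assoc,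
      ← pow_add]
    have : ρ ^ (2 * ((m - 1) / 2) + 2) ≤ ρ ^ m := pow_le_pow_of_le_one hρ0.le hρ1 (by omega)
    linarith

/-! ### Matrices with Hermitian part bounded below -/

section Coercive

variable {ι κ : Type*} [Fintype ι] [Fintype κ]

/-- The Hermitian part of `M` is bounded below by `c`. -/
def IsCoerciveWith (c : ℝ) (M : Matrix ι ι ℂ) : Prop :=
  ∀ v : ι → ℂ, c * ‖WithLp.toLp 2 v‖ ^ 2 ≤ (star v ⬝ᵥ M *ᵥ v).re

lemma norm_toLp_sq_eq_re (v : ι → ℂ) : ‖WithLp.toLp 2 v‖ ^ 2 = (star v ⬝ᵥ v).re := by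
  rw [EuclideanSpace.norm_sq_eq, dotProduct, Complex.re_sum]
  refine Finset.sum_congr rfl fun i _ => ?_
  rw [← Complex.normSq_eq_norm_sq, Complex.normSq_apply]
  simp [Complex.mul_re]

lemma norm_star_dotProduct_le (v w : ι → ℂ) :
    ‖star v ⬝ᵥ w‖ ≤ ‖WithLp.toLp 2 v‖ * ‖WithLp.toLp 2 w‖ := by
  have := norm_inner_le_norm (𝕜 := ℂ) (WithLp.toLp 2 v) (WithLp.toLp 2 w)
  rwa [EuclideanSpace.inner_toLp_toLp, dotProduct_comm] at this

lemma norm_toLp_mulVec_le [DecidableEq κ] (M : Matrix ι κ ℂ) (v : κ → ℂ) :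
    ‖WithLp.toLp 2 (M *ᵥ v)‖ ≤ ‖M‖ * ‖WithLp.toLp 2 v‖ :=
  Matrix.l2_opNorm_mulVec M (WithLp.toLp 2 v)

lemma l2_opNorm_le_of_forall [DecidableEq κ] {M : Matrix ι κ ℂ} {c : ℝ} (hc : 0 ≤ c)
    (h : ∀ v : κ → ℂ, ‖WithLp.toLp 2 (M *ᵥ v)‖ ≤ c * ‖WithLp.toLp 2 v‖) : ‖M‖ ≤ c := by
  rw [Matrix.l2_opNorm_def]
  exact ContinuousLinearMap.opNorm_le_bound _ hc fun x => h x.ofLp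

lemma norm_vecMulVec_le [DecidableEq κ] (v : ι → ℂ) (w : κ → ℂ) :
    ‖vecMulVec v (star w)‖ ≤ ‖WithLp.toLp 2 v‖ * ‖WithLp.toLp 2 w‖ := by
  refine l2_opNorm_le_of_forall (by positivity) fun x => ?_
  rw [vecMulVec_mulVec]
  have h : WithLp.toLp 2 (MulOpposite.op (star w ⬝ᵥ x) • v) = (star w ⬝ᵥ x) • WithLp.toLp 2 v := by
    ext i
    simp [mul_comm]
  rw [h, norm_smul]
  have := mul_le_mul_of_nonneg_right (norm_star_dotProduct_le w x) (norm_nonneg (WithLp.toLp 2 v))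
  linarith

namespace IsCoerciveWith

variable {c : ℝ} {M : Matrix ι ι ℂ}

lemma mul_norm_le (h : IsCoerciveWith c M) (v : ι → ℂ) :
    c * ‖WithLp.toLp 2 v‖ ≤ ‖WithLp.toLp 2 (M *ᵥ v)‖ := by
  rcases (norm_nonneg (WithLp.toLp 2 v)).eq_or_lt with h0 | h0
  · rw [← h0, mul_zero]
    exact norm_nonneg _
  · have h1 := (h v).trans ((Complex.re_le_norm _).trans (norm_star_dotProduct_le v (M *ᵥ v)))
    rw [pow_two, ← mul_assoc, mul_comm] at h1
    exact le_of_mul_le_mul_left h1 h0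

lemma isUnit [DecidableEq ι] (h : IsCoerciveWith c M) (hc : 0 < c) : IsUnit M := by
  rw [← Matrix.mulVec_injective_iff_isUnit]
  intro v w hvw
  have h1 := h.mul_norm_le (v - w)
  rw [Matrix.mulVec_sub, sub_eq_zero.mpr hvw, WithLp.toLp_zero, norm_zero] at h1
  have h2 : ‖WithLp.toLp 2 (v - w)‖ = 0 := by
    have := norm_nonneg (WithLp.toLp 2 (v - w))
    nlinarith
  rw [norm_eq_zero, WithLp.toLp_eq_zero] at h2
  exact sub_eq_zero.mp h2

lemma isUnit_det [DecidableEq ι] (h : IsCoerciveWith c M) (hc : 0 < c) : IsUnit M.det :=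
  (Matrix.isUnit_iff_isUnit_det M).mp (h.isUnit hc)

lemma norm_inv_le [DecidableEq ι] (h : IsCoerciveWith c M) (hc : 0 < c) : ‖M⁻¹‖ ≤ c⁻¹ := by
  refine l2_opNorm_le_of_forall (by positivity) fun v => ?_
  have h1 := h.mul_norm_le (M⁻¹ *ᵥ v)
  rw [Matrix.mulVec_mulVec, Matrix.mul_nonsing_inv _ (h.isUnit_det hc), Matrix.one_mulVec] at h1
  rw [inv_mul_eq_div, le_div_iff₀ hc]
  linarith

lemma add_smul_one [DecidableEq ι] (h : IsCoerciveWith c M) (t : ℝ) :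
    IsCoerciveWith (c + t) (M + (t : ℂ) • (1 : Matrix ι ι ℂ)) := by
  intro v
  have := h v
  rw [Matrix.add_mulVec, Matrix.smul_mulVec, Matrix.one_mulVec, dotProduct_add, dotProduct_smul,
    Complex.add_re, smul_eq_mul, Complex.re_ofReal_mul, ← norm_toLp_sq_eq_re]
  linarith

lemma mono {c' : ℝ} (h : IsCoerciveWith c M) (hc : c' ≤ c) : IsCoerciveWith c' M := fun v =>
  (mul_le_mul_of_nonneg_right hc (by positivity)).trans (h v)

/-- Coercivity is an open condition that does not require N to be Hermitian. Fréchet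
differentiability needs this, as the neighbours of A are arbitrary complex matrices. -/
lemma perturb [DecidableEq ι] (h : IsCoerciveWith c M) (N : Matrix ι ι ℂ) :
    IsCoerciveWith (c - ‖N - M‖) N := by
  intro v
  have h1 := h v
  have h2 : star v ⬝ᵥ N *ᵥ v = star v ⬝ᵥ M *ᵥ v + star v ⬝ᵥ (N - M) *ᵥ v := by
    rw [← dotProduct_add, ← Matrix.add_mulVec, add_sub_cancel]
  have h3 : -(star v ⬝ᵥ (N - M) *ᵥ v).re ≤ ‖N - M‖ * ‖WithLp.toLp 2 v‖ ^ 2 := by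
    calc _ ≤ ‖star v ⬝ᵥ (N - M) *ᵥ v‖ := (neg_le_abs _).trans (Complex.abs_re_le_norm _)
      _ ≤ _ := norm_star_dotProduct_le _ _
      _ ≤ ‖WithLp.toLp 2 v‖ * (‖N - M‖ * ‖WithLp.toLp 2 v‖) := by
        gcongr
        exact norm_toLp_mulVec_le _ _
      _ = _ := by ring
  rw [h2, Complex.add_re]
  linarith

lemma compress [DecidableEq κ] (h : IsCoerciveWith c M) {V : Matrix ι κ ℂ} (hV : Vᴴ * V = 1) :
    IsCoerciveWith c (Vᴴ * M * V) := by
  intro v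
  have h1 := h (V *ᵥ v)
  rw [norm_toLp_sq_eq_re] at h1 ⊢
  have h2 : star (V *ᵥ v) ⬝ᵥ V *ᵥ v = star v ⬝ᵥ v := by
    rw [Matrix.star_mulVec, ← dotProduct_mulVec, Matrix.mulVec_mulVec, hV, Matrix.one_mulVec]
  have h3 : star (V *ᵥ v) ⬝ᵥ M *ᵥ V *ᵥ v = star v ⬝ᵥ (Vᴴ * M * V) *ᵥ v := by
    rw [Matrix.star_mulVec, ← dotProduct_mulVec, Matrix.mulVec_mulVec, Matrix.mulVec_mulVec,
      Matrix.mul_assoc]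
  rwa [h2, h3] at h1

open scoped MatrixOrder in
lemma of_isHermitian [DecidableEq ι] (hM : M.IsHermitian) (h : ∀ x ∈ spectrum ℝ M, c ≤ x) :
    IsCoerciveWith c M := by
  have h1 : (M - algebraMap ℝ _ c).PosSemidef := by
    rw [← Matrix.le_iff]
    exact (algebraMap_le_iff_le_spectrum (A := Matrix ι ι ℂ) (r := c) (a := M) hM).mpr h
  intro v
  have h2 := (Complex.le_def.mp (h1.dotProduct_mulVec_nonneg v)).1
  rw [Matrix.sub_mulVec, dotProduct_sub, Complex.sub_re, Complex.zero_re,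
    Algebra.algebraMap_eq_smul_one, Matrix.smul_mulVec, Matrix.one_mulVec, dotProduct_smul,
    Complex.smul_re, smul_eq_mul, ← norm_toLp_sq_eq_re] at h2
  linarith

end IsCoerciveWith
end Coercive

/-! ### Resolvent bounds and differentiation under the integral -/

section Resolvent

variable {ι : Type*} [Fintype ι] [DecidableEq ι] {ν : Measure ℝ} {c : ℝ} {M : Matrix ι ι ℂ}

lemma IsCoerciveWith.continuousOn_resolvent (h : IsCoerciveWith c M) (hc : 0 < c) :
    ContinuousOn (fun t : ℝ => (M + (t : ℂ) • (1 : Matrix ι ι ℂ))⁻¹) (Set.Ici 0) := by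
  intro t ht
  have h1 := (h.add_smul_one t).isUnit (add_pos_of_pos_of_nonneg hc ht)
  obtain ⟨u, hu⟩ := h1
  simp_rw [Matrix.nonsing_inv_eq_ringInverse]
  have h2 : ContinuousAt Ring.inverse (M + (t : ℂ) • (1 : Matrix ι ι ℂ)) :=
    hu ▸ NormedRing.inverse_continuousAt u
  refine (ContinuousAt.comp (f := fun t : ℝ => M + (t : ℂ) • (1 : Matrix ι ι ℂ)) h2
    ?_).continuousWithinAt
  fun_prop

lemma IsCoerciveWith.norm_resolvent_le (h : IsCoerciveWith c M) (hc : 0 < c) {t : ℝ}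
    (ht : 0 ≤ t) : ‖(M + (t : ℂ) • (1 : Matrix ι ι ℂ))⁻¹‖ ≤ (c + t)⁻¹ :=
  (h.add_smul_one t).norm_inv_le (add_pos_of_pos_of_nonneg hc ht)

lemma integrableOn_inv_add (hν : IntegrableOn (fun t : ℝ => 1 / (1 + t)) (Set.Ici 0) ν)
    (hc : 0 < c) : IntegrableOn (fun t : ℝ => (c + t)⁻¹) (Set.Ici 0) ν := by
  refine Integrable.mono' (hν.const_mul (max 1 c⁻¹)) ?_ ?_
  · refine ContinuousOn.aestronglyMeasurable (fun t ht => ?_) measurableSet_Ici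
    have : c + t ≠ 0 := (add_pos_of_pos_of_nonneg hc ht).ne'
    exact ContinuousAt.continuousWithinAt (by fun_prop (disch := assumption))
  · refine (ae_restrict_iff' measurableSet_Ici).mpr (.of_forall fun t (ht : 0 ≤ t) => ?_)
    have h1 : 0 < c + t := by positivity
    rw [Real.norm_of_nonneg (by positivity), mul_one_div, le_div_iff₀ (by positivity),
      inv_mul_eq_div, div_le_iff₀ h1]
    have h2 := le_max_left 1 c⁻¹
    have h3 : 1 ≤ max 1 c⁻¹ * c := by
      rw [← inv_mul_cancel₀ hc.ne']
      gcongr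
      exact le_max_right _ _
    nlinarith

lemma integrableOn_inv_add_sq (hν : IntegrableOn (fun t : ℝ => 1 / (1 + t)) (Set.Ici 0) ν)
    (hc : 0 < c) : IntegrableOn (fun t : ℝ => (c + t)⁻¹ ^ 2) (Set.Ici 0) ν := by
  have h := integrableOn_inv_add hν hc
  refine Integrable.mono' (h.const_mul c⁻¹) (h.aestronglyMeasurable.pow 2) ?_
  refine (ae_restrict_iff' measurableSet_Ici).mpr (.of_forall fun t (ht : 0 ≤ t) => ?_)
  rw [Real.norm_of_nonneg (by positivity), pow_two]
  gcongr
  linarith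

lemma IsCoerciveWith.integrableOn_resolvent (h : IsCoerciveWith c M) (hc : 0 < c)
    (hν : IntegrableOn (fun t : ℝ => 1 / (1 + t)) (Set.Ici 0) ν) :
    IntegrableOn (fun t : ℝ => (M + (t : ℂ) • (1 : Matrix ι ι ℂ))⁻¹) (Set.Ici 0) ν :=
  Integrable.mono' (integrableOn_inv_add hν hc)
    ((h.continuousOn_resolvent hc).aestronglyMeasurable measurableSet_Ici)
    ((ae_restrict_iff' measurableSet_Ici).mpr (.of_forall fun _ ht => h.norm_resolvent_le hc ht))

/-- The derivative of `M ↦ (M + t I)⁻¹`. -/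
noncomputable def resolventFDeriv (M : Matrix ι ι ℂ) (t : ℝ) :
    Matrix ι ι ℂ →L[ℂ] Matrix ι ι ℂ :=
  -ContinuousLinearMap.mulLeftRight ℂ (Matrix ι ι ℂ) (M + (t : ℂ) • (1 : Matrix ι ι ℂ))⁻¹
    (M + (t : ℂ) • (1 : Matrix ι ι ℂ))⁻¹

lemma resolventFDeriv_apply (M E : Matrix ι ι ℂ) (t : ℝ) :
    resolventFDeriv M t E = -((M + (t : ℂ) • (1 : Matrix ι ι ℂ))⁻¹ * E *
      (M + (t : ℂ) • (1 : Matrix ι ι ℂ))⁻¹) := rfl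

lemma IsCoerciveWith.hasFDerivAt_resolvent (h : IsCoerciveWith c M) (hc : 0 < c) {t : ℝ}
    (ht : 0 ≤ t) : HasFDerivAt (fun N : Matrix ι ι ℂ => (N + (t : ℂ) • (1 : Matrix ι ι ℂ))⁻¹)
      (resolventFDeriv M t) M := by
  obtain ⟨u, hu⟩ := (h.add_smul_one t).isUnit (add_pos_of_pos_of_nonneg hc ht)
  have h1 := hasFDerivAt_ringInverse (𝕜 := ℂ) u
  have h2 : (↑u⁻¹ : Matrix ι ι ℂ) = (M + (t : ℂ) • (1 : Matrix ι ι ℂ))⁻¹ := by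
    rw [← hu, Matrix.coe_units_inv]
  rw [h2, hu] at h1
  simp_rw [Matrix.nonsing_inv_eq_ringInverse]
  have h3 := h1.comp M ((hasFDerivAt_id (𝕜 := ℂ) M).add_const ((t : ℂ) • (1 : Matrix ι ι ℂ)))
  rw [ContinuousLinearMap.comp_id] at h3
  exact h3

lemma IsCoerciveWith.norm_resolventFDeriv_le (h : IsCoerciveWith c M) (hc : 0 < c) {t : ℝ}
    (ht : 0 ≤ t) : ‖resolventFDeriv M t‖ ≤ (c + t)⁻¹ ^ 2 := by
  have h1 := h.norm_resolvent_le hc ht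
  have h0 : 0 ≤ (c + t)⁻¹ := (norm_nonneg _).trans h1
  refine ContinuousLinearMap.opNorm_le_bound _ (by positivity) fun E => ?_
  rw [resolventFDeriv_apply, norm_neg]
  calc _ ≤ (c + t)⁻¹ * ‖E‖ * (c + t)⁻¹ := by
        refine (norm_mul_le _ _).trans (mul_le_mul ((norm_mul_le _ _).trans ?_) h1
          (norm_nonneg _) (by positivity))
        gcongr
    _ = _ := by ring

lemma IsCoerciveWith.integrableOn_resolventFDeriv (h : IsCoerciveWith c M) (hc : 0 < c)
    (hν : IntegrableOn (fun t : ℝ => 1 / (1 + t)) (Set.Ici 0) ν) :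
    IntegrableOn (resolventFDeriv M) (Set.Ici 0) ν := by
  refine Integrable.mono' (f := resolventFDeriv M) (integrableOn_inv_add_sq hν hc) ?_
    ((ae_restrict_iff' measurableSet_Ici).mpr
      (.of_forall fun _ ht => h.norm_resolventFDeriv_le hc ht))
  refine ContinuousOn.aestronglyMeasurable ?_ measurableSet_Ici
  have h1 := h.continuousOn_resolvent hc
  have h2 : Continuous fun p : Matrix ι ι ℂ × Matrix ι ι ℂ =>
      ContinuousLinearMap.mulLeftRight ℂ (Matrix ι ι ℂ) p.1 p.2 := by fun_prop
  exact (h2.comp_continuousOn (h1.prodMk h1)).neg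

/-- The matrix Stieltjes function is differentiable at coercive matrices. -/
lemma IsCoerciveWith.hasFDerivAt_stieltjesMatrixFun (h : IsCoerciveWith c M) (hc : 0 < c)
    (hν : IntegrableOn (fun t : ℝ => 1 / (1 + t)) (Set.Ici 0) ν) :
    HasFDerivAt (stieltjesMatrixFun (ι := ι) ν)
      (∫ t in Set.Ici (0 : ℝ), resolventFDeriv M t ∂ν) M := by
  -- On the ball of radius c/2 every matrix keeps coercivity c/2, which gives one integrable bound
  -- for all derivatives.
  have hball : ∀ N ∈ Metric.ball M (c / 2), IsCoerciveWith (c / 2) N := fun N hN => by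
    rw [Metric.mem_ball, dist_eq_norm] at hN
    exact (h.perturb N).mono (by linarith)
  have hc2 : 0 < c / 2 := by positivity
  refine hasFDerivAt_integral_of_dominated_of_fderiv_le (F' := resolventFDeriv)
    (s := Metric.ball M (c / 2))
    (bound := fun t => (c / 2 + t)⁻¹ ^ 2) (Metric.ball_mem_nhds M hc2) ?_
    (h.integrableOn_resolvent hc hν) (h.integrableOn_resolventFDeriv hc hν).aestronglyMeasurable
    ?_ (integrableOn_inv_add_sq hν hc2) ?_
  · filter_upwards [Metric.ball_mem_nhds M hc2] with N hN
    exact ((hball N hN).integrableOn_resolvent hc2 hν).aestronglyMeasurable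
  · exact (ae_restrict_iff' measurableSet_Ici).mpr
      (.of_forall fun t ht N hN => (hball N hN).norm_resolventFDeriv_le hc2 ht)
  · exact (ae_restrict_iff' measurableSet_Ici).mpr
      (.of_forall fun t ht N hN => (hball N hN).hasFDerivAt_resolvent hc2 ht)

lemma IsCoerciveWith.stieltjesFrechet_eq (h : IsCoerciveWith c M) (hc : 0 < c)
    (hν : IntegrableOn (fun t : ℝ => 1 / (1 + t)) (Set.Ici 0) ν) (E : Matrix ι ι ℂ) :
    stieltjesFrechet ν M E = ∫ t in Set.Ici (0 : ℝ), resolventFDeriv M t E ∂ν := by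
  rw [stieltjesFrechet, (h.hasFDerivAt_stieltjesMatrixFun hc hν).fderiv,
    ContinuousLinearMap.integral_apply (h.integrableOn_resolventFDeriv hc hν)]

end Resolvent

/-! ### The off-diagonal block of the block triangular matrix function -/

section Block

variable {κ l : Type*} [Fintype κ] [DecidableEq κ] [Fintype l] [DecidableEq l]
  {ν : Measure ℝ} {c : ℝ} {M : Matrix κ κ ℂ} {N : Matrix l l ℂ}

lemma integrableOn_resolvent_mul_mul_resolvent (hM : IsCoerciveWith c M) (hN : IsCoerciveWith c N)
    (hc : 0 < c) (hν : IntegrableOn (fun t : ℝ => 1 / (1 + t)) (Set.Ici 0) ν)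
    (E : Matrix κ l ℂ) :
    IntegrableOn (fun t : ℝ => (M + (t : ℂ) • (1 : Matrix κ κ ℂ))⁻¹ * E *
      (N + (t : ℂ) • (1 : Matrix l l ℂ))⁻¹) (Set.Ici 0) ν := by
  refine Integrable.mono' ((integrableOn_inv_add_sq hν hc).mul_const ‖E‖) ?_
    ((ae_restrict_iff' measurableSet_Ici).mpr (.of_forall fun t ht => ?_))
  · refine ContinuousOn.aestronglyMeasurable ?_ measurableSet_Ici
    have h : Continuous fun p : Matrix κ κ ℂ × Matrix l l ℂ => p.1 * E * p.2 :=
      (continuous_fst.matrix_mul continuous_const).matrix_mul continuous_snd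
    have h1 := (hM.continuousOn_resolvent hc).prodMk (hN.continuousOn_resolvent hc)
    exact Continuous.comp_continuousOn
      (f := fun t : ℝ => ((M + (t : ℂ) • (1 : Matrix κ κ ℂ))⁻¹,
        (N + (t : ℂ) • (1 : Matrix l l ℂ))⁻¹)) h h1
  · have h1 := hM.norm_resolvent_le hc ht
    have h2 := hN.norm_resolvent_le hc ht
    have h0 : 0 ≤ (c + t)⁻¹ := (norm_nonneg _).trans h1
    calc _ ≤ (c + t)⁻¹ * ‖E‖ * (c + t)⁻¹ := by
          refine (Matrix.l2_opNorm_mul _ _).trans (mul_le_mul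
            ((Matrix.l2_opNorm_mul _ _).trans ?_) h2 (norm_nonneg _) (by positivity))
          gcongr
      _ = _ := by ring

lemma resolvent_fromBlocks (hM : IsCoerciveWith c M) (hN : IsCoerciveWith c N)
    (hc : 0 < c) (E : Matrix κ l ℂ) {t : ℝ} (ht : 0 ≤ t) :
    (fromBlocks M E 0 N + (t : ℂ) • (1 : Matrix (κ ⊕ l) (κ ⊕ l) ℂ))⁻¹ =
      fromBlocks (M + (t : ℂ) • (1 : Matrix κ κ ℂ))⁻¹
        (-((M + (t : ℂ) • (1 : Matrix κ κ ℂ))⁻¹ * E * (N + (t : ℂ) • (1 : Matrix l l ℂ))⁻¹)) 0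
        (N + (t : ℂ) • (1 : Matrix l l ℂ))⁻¹ := by
  have hct : 0 < c + t := by positivity
  rw [← fromBlocks_one, fromBlocks_smul, fromBlocks_add, smul_zero, smul_zero, add_zero, add_zero,
    Matrix.inv_fromBlocks_zero₂₁_of_isUnit_iff]
  exact iff_of_true ((hM.add_smul_one t).isUnit hct) ((hN.add_smul_one t).isUnit hct)

lemma stieltjesMatrixFun_fromBlocks_toBlocks₁₂ (hM : IsCoerciveWith c M)
    (hN : IsCoerciveWith c N) (hc : 0 < c)
    (hν : IntegrableOn (fun t : ℝ => 1 / (1 + t)) (Set.Ici 0) ν) (E : Matrix κ l ℂ) :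
    (stieltjesMatrixFun ν (fromBlocks M E 0 N)).toBlocks₁₂ =
      -∫ t in Set.Ici (0 : ℝ), (M + (t : ℂ) • (1 : Matrix κ κ ℂ))⁻¹ * E *
        (N + (t : ℂ) • (1 : Matrix l l ℂ))⁻¹ ∂ν := by
  -- Block extraction commutes with the Bochner integral only once the whole block resolvent is
  -- integrable; Φ assembles it linearly from three integrable blocks.
  let Φ : (Matrix κ κ ℂ × Matrix κ l ℂ × Matrix l l ℂ) →ₗ[ℂ] Matrix (κ ⊕ l) (κ ⊕ l) ℂ :=
    { toFun := fun p => fromBlocks p.1 (-p.2.1) 0 p.2.2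
      map_add' := fun p q => by simp [fromBlocks_add, add_comm]
      map_smul' := fun r p => by simp [fromBlocks_smul] }
  let Ψ : Matrix (κ ⊕ l) (κ ⊕ l) ℂ →ₗ[ℂ] Matrix κ l ℂ :=
    { toFun := toBlocks₁₂
      map_add' := fun _ _ => rfl
      map_smul' := fun _ _ => rfl }
  have h1 := (hM.integrableOn_resolvent hc hν).prodMk
    ((integrableOn_resolvent_mul_mul_resolvent hM hN hc hν E).prodMk
      (hN.integrableOn_resolvent hc hν))
  have h2 := (LinearMap.toContinuousLinearMap Φ).integrable_comp h1
  have h3 := (LinearMap.toContinuousLinearMap Ψ).integral_comp_comm h2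
  rw [stieltjesMatrixFun, setIntegral_congr_fun measurableSet_Ici
    (fun t ht => resolvent_fromBlocks hM hN hc E ht), ← integral_neg]
  exact h3.symm

end Block

/-! ### Galerkin resolvents and quasi-optimality -/

section Galerkin

variable {n k l : ℕ} {ν : Measure ℝ} {c : ℝ} {A : Matrix (Fin n) (Fin n) ℂ}
  {V : Matrix (Fin n) (Fin k) ℂ} {W : Matrix (Fin n) (Fin l) ℂ}

/-- The Galerkin approximation `V (Vᴴ A V + t I)⁻¹ Vᴴ` of the resolvent. -/
noncomputable def galerkinResolvent (A : Matrix (Fin n) (Fin n) ℂ) (V : Matrix (Fin n) (Fin k) ℂ)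
    (t : ℝ) : Matrix (Fin n) (Fin n) ℂ :=
  V * (Vᴴ * A * V + (t : ℂ) • (1 : Matrix (Fin k) (Fin k) ℂ))⁻¹ * Vᴴ

/-- The off-diagonal block is Vᴴ E W with E = η y zᴴ, so the outer V and Wᴴ can be absorbed into the
two Galerkin resolvents. -/
lemma integrableOn_galerkin_and_krylovFrechetApprox_eq (hA : IsCoerciveWith c A) (hc : 0 < c)
    (hν : IntegrableOn (fun t : ℝ => 1 / (1 + t)) (Set.Ici 0) ν) (hV : Vᴴ * V = 1)
    (hW : Wᴴ * W = 1) (η : ℂ) (y z : Fin n → ℂ) :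
    IntegrableOn (fun t : ℝ => galerkinResolvent A V t * (η • vecMulVec y (star z)) *
      galerkinResolvent A W t) (Set.Ici 0) ν ∧
    krylovFrechetApprox ν A η y z V W =
      -∫ t in Set.Ici (0 : ℝ), galerkinResolvent A V t * (η • vecMulVec y (star z)) *
        galerkinResolvent A W t ∂ν := by
  let Φ : Matrix (Fin k) (Fin l) ℂ →ₗ[ℂ] Matrix (Fin n) (Fin n) ℂ :=
    { toFun := fun X => V * X * Wᴴ
      map_add' := fun X Y => by rw [Matrix.mul_add, Matrix.add_mul]
      map_smul' := fun r X => by simp }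
  have hE : η • vecMulVec (Vᴴ *ᵥ y) (star (Wᴴ *ᵥ z)) = Vᴴ * (η • vecMulVec y (star z)) * W := by
    rw [Matrix.mul_smul, Matrix.smul_mul, Matrix.mul_vecMulVec, Matrix.vecMulVec_mul,
      Matrix.star_mulVec, conjTranspose_conjTranspose]
  have h1 := integrableOn_resolvent_mul_mul_resolvent (hA.compress hV) (hA.compress hW) hc hν
    (Vᴴ * (η • vecMulVec y (star z)) * W)
  have h2 (t : ℝ) : (LinearMap.toContinuousLinearMap Φ)
      ((Vᴴ * A * V + (t : ℂ) • (1 : Matrix (Fin k) (Fin k) ℂ))⁻¹ *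
        (Vᴴ * (η • vecMulVec y (star z)) * W) *
        (Wᴴ * A * W + (t : ℂ) • (1 : Matrix (Fin l) (Fin l) ℂ))⁻¹) =
      galerkinResolvent A V t * (η • vecMulVec y (star z)) * galerkinResolvent A W t := by
    simp only [galerkinResolvent, LinearMap.coe_toContinuousLinearMap', Φ, LinearMap.coe_mk,
      AddHom.coe_mk, Matrix.mul_assoc]
  have h3 := (LinearMap.toContinuousLinearMap Φ).integrable_comp h1
  have h4 := (LinearMap.toContinuousLinearMap Φ).integral_comp_comm h1
  simp only [h2] at h3 h4
  refine ⟨h3, ?_⟩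
  rw [krylovFrechetApprox, hE, stieltjesMatrixFun_fromBlocks_toBlocks₁₂ (hA.compress hV)
    (hA.compress hW) hc hν, h4]
  simp [Φ]

lemma l2_opNorm_le_one_of_conjTranspose_mul_self (hV : Vᴴ * V = 1) : ‖V‖ ≤ 1 := by
  have h1 := Matrix.l2_opNorm_conjTranspose_mul_self V
  rw [hV] at h1
  have h2 : ‖(1 : Matrix (Fin k) (Fin k) ℂ)‖ ≤ 1 :=
    l2_opNorm_le_of_forall zero_le_one fun v => by rw [Matrix.one_mulVec, one_mul]
  nlinarith [norm_nonneg V]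

lemma norm_galerkinResolvent_le (hA : IsCoerciveWith c A) (hc : 0 < c) (hV : Vᴴ * V = 1) {t : ℝ}
    (ht : 0 ≤ t) : ‖galerkinResolvent A V t‖ ≤ (c + t)⁻¹ := by
  have h1 := (hA.compress hV).norm_resolvent_le hc ht
  have h2 := l2_opNorm_le_one_of_conjTranspose_mul_self hV
  have h3 : ‖Vᴴ‖ ≤ 1 := (Matrix.l2_opNorm_conjTranspose V).trans_le h2
  have h0 : 0 ≤ (c + t)⁻¹ := (norm_nonneg _).trans h1
  calc _ ≤ 1 * (c + t)⁻¹ * 1 := by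
        refine (Matrix.l2_opNorm_mul _ _).trans (mul_le_mul
          ((Matrix.l2_opNorm_mul _ _).trans ?_) h3 (norm_nonneg _) (by positivity))
        gcongr
    _ = _ := by ring

lemma isHermitian_galerkinResolvent (hA : A.IsHermitian) (t : ℝ) :
    (galerkinResolvent A V t).IsHermitian := by
  have h1 : (Vᴴ * A * V + (t : ℂ) • (1 : Matrix (Fin k) (Fin k) ℂ)).IsHermitian := by
    refine (isHermitian_conjTranspose_mul_mul V hA).add ?_
    rw [Matrix.IsHermitian, conjTranspose_smul, conjTranspose_one]
    simp
  exact isHermitian_mul_mul_conjTranspose V h1.inv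

/-- Orthonormality gives Vᴴ(A + tI)V = VᴴAV + tI, which cancels the inverse. Thus G(A + tI) is a
projection, in general oblique, onto the range of V. -/
lemma galerkinResolvent_mul_mul (hA : IsCoerciveWith c A) (hc : 0 < c) (hV : Vᴴ * V = 1) {t : ℝ}
    (ht : 0 ≤ t) :
    galerkinResolvent A V t * (A + (t : ℂ) • (1 : Matrix (Fin n) (Fin n) ℂ)) * V = V := by
  have hu := ((hA.compress hV).add_smul_one t).isUnit_det (by positivity)
  have h1 : Vᴴ * (A + (t : ℂ) • (1 : Matrix (Fin n) (Fin n) ℂ)) * V =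
      Vᴴ * A * V + (t : ℂ) • (1 : Matrix (Fin k) (Fin k) ℂ) := by
    rw [Matrix.mul_add, Matrix.add_mul, Matrix.mul_smul, Matrix.smul_mul, Matrix.mul_one, hV]
  rw [galerkinResolvent, Matrix.mul_assoc, Matrix.mul_assoc, Matrix.mul_assoc,
    ← Matrix.mul_assoc Vᴴ, h1, Matrix.nonsing_inv_mul _ hu, Matrix.mul_one]

/-- Quasi-optimality of the Galerkin approximation. -/
lemma norm_resolvent_sub_galerkinResolvent_mulVec_le (hA : IsCoerciveWith c A) (hc : 0 < c)
    {b : ℝ} (hb : ‖A‖ ≤ b) (hcb : c ≤ b) {S : Submodule ℂ (Fin n → ℂ)}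
    (hV : IsOrthonormalBasisOf V S) {t : ℝ} (ht : 0 ≤ t) (y v : Fin n → ℂ) (hv : v ∈ S) :
    ‖WithLp.toLp 2 (((A + (t : ℂ) • (1 : Matrix (Fin n) (Fin n) ℂ))⁻¹ - galerkinResolvent A V t)
      *ᵥ y)‖ ≤ (1 + b / c) * ‖WithLp.toLp 2
        ((A + (t : ℂ) • (1 : Matrix (Fin n) (Fin n) ℂ))⁻¹ *ᵥ y - v)‖ := by
  obtain ⟨u, rfl⟩ : ∃ u, V *ᵥ u = v := by
    rw [← hV.2, ← Matrix.range_mulVecLin] at hv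
    exact hv
  set B := A + (t : ℂ) • (1 : Matrix (Fin n) (Fin n) ℂ) with hB
  have hct : 0 < c + t := by positivity
  have hdet : IsUnit B.det := (hA.add_smul_one t).isUnit_det hct
  -- As 1 - GB annihilates the range of V, any v in S may be subtracted from B⁻¹y.
  have h1 : (B⁻¹ - galerkinResolvent A V t) *ᵥ y =
      (1 - galerkinResolvent A V t * B) *ᵥ (B⁻¹ *ᵥ y - V *ᵥ u) := by
    rw [Matrix.mulVec_sub, Matrix.mulVec_mulVec, Matrix.mulVec_mulVec, Matrix.sub_mul,
      Matrix.sub_mul, galerkinResolvent_mul_mul hA hc hV.1 ht, Matrix.one_mul, Matrix.one_mul,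
      sub_self, Matrix.zero_mulVec, sub_zero, Matrix.mul_assoc, Matrix.mul_nonsing_inv _ hdet,
      Matrix.mul_one]
  have hone : ‖(1 : Matrix (Fin n) (Fin n) ℂ)‖ ≤ 1 :=
    l2_opNorm_le_of_forall zero_le_one fun v => by rw [Matrix.one_mulVec, one_mul]
  have hBnorm : ‖B‖ ≤ b + t := by
    refine (norm_add_le _ _).trans (add_le_add hb ?_)
    rw [norm_smul, Complex.norm_real, Real.norm_of_nonneg ht]
    exact mul_le_of_le_one_right ht hone
  -- The bound is uniform in t because (b + t)/(c + t) ≤ b/c when c ≤ b.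
  have h2 : ‖1 - galerkinResolvent A V t * B‖ ≤ 1 + b / c := by
    refine (norm_sub_le _ _).trans (add_le_add hone ((norm_mul_le _ _).trans ?_))
    calc _ ≤ (c + t)⁻¹ * (b + t) := mul_le_mul (norm_galerkinResolvent_le hA hc hV.1 ht) hBnorm
          (norm_nonneg _) (by positivity)
      _ ≤ b / c := by
        rw [inv_mul_eq_div, div_le_div_iff₀ hct hc]
        nlinarith
  rw [h1]
  exact (norm_toLp_mulVec_le _ _).trans (mul_le_mul_of_nonneg_right h2 (norm_nonneg _))

end Galerkin

/-! ### From matrix to scalar approximation in the extended Krylov space -/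

section ExtendedKrylov

variable {n : ℕ} {A : Matrix (Fin n) (Fin n) ℂ}

lemma denomPoly_extendedPoles (m : ℕ) :
    denomPoly extendedPoles m = Polynomial.X ^ ((m - 1) / 2) := by
  rw [denomPoly]
  induction m - 1 with
  | zero => simp
  | succ N ih =>
    rw [Finset.prod_Icc_succ_top (by omega), ih, extendedPoles]
    split_ifs with h
    · have h1 : poleFactor OnePoint.infty = 1 := rfl
      rw [h1, mul_one]
      congr 1
      obtain ⟨j, hj⟩ := h
      omega
    · have h1 : poleFactor ((0 : ℂ) : OnePoint ℂ) = Polynomial.X - Polynomial.C 0 := rfl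
      rw [h1, Polynomial.C_0, sub_zero, ← pow_succ]
      congr 1
      obtain ⟨j, hj⟩ := Nat.not_odd_iff_even.mp h
      omega

lemma aeval_mulVec_mem_krylov (A : Matrix (Fin n) (Fin n) ℂ) (y : Fin n → ℂ) {m : ℕ}
    {p : Polynomial ℝ} (hp : p.natDegree < m) : Polynomial.aeval A p *ᵥ y ∈ krylov A y m := by
  rw [Polynomial.aeval_eq_sum_range' hp, Matrix.sum_mulVec]
  refine Submodule.sum_mem _ fun i hi => ?_
  have h : (p.coeff i • A ^ i) *ᵥ y = (p.coeff i : ℂ) • (A ^ i *ᵥ y) := by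
    rw [Matrix.smul_mulVec]
    ext j
    simp
  rw [h]
  exact Submodule.smul_mem _ _ (Submodule.subset_span ⟨⟨i, Finset.mem_range.mp hi⟩, rfl⟩)

/-- With B = A + tI and v = A⁻ˢp(A)y, the error is B⁻¹(1 - B p(A)A⁻ˢ)y. The functional calculus
bounds the middle factor by the scalar error on the spectrum. -/
lemma exists_mem_rationalKrylov_norm_sub_le (hA : A.IsHermitian) {a b : ℝ} (ha : 0 < a)
    (hsp : spectrum ℝ A ⊆ Set.Icc a b) (y : Fin n → ℂ)
    (hy : ‖(WithLp.toLp 2 y : EuclideanSpace ℂ (Fin n))‖ = 1) {m : ℕ} {t ε : ℝ} (ht : 0 ≤ t)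
    {p : Polynomial ℝ} (hdeg : p.natDegree < m) (hε : 0 ≤ ε)
    (hp : ∀ x ∈ Set.Icc a b, |1 - (x + t) * (p.eval x / x ^ ((m - 1) / 2))| ≤ ε) :
    ∃ v ∈ rationalKrylov A y extendedPoles m, ‖WithLp.toLp 2
      ((A + (t : ℂ) • (1 : Matrix (Fin n) (Fin n) ℂ))⁻¹ *ᵥ y - v)‖ ≤ (a + t)⁻¹ * ε := by
  set s := (m - 1) / 2
  set B := A + (t : ℂ) • (1 : Matrix (Fin n) (Fin n) ℂ) with hB
  have hco : IsCoerciveWith a A := .of_isHermitian hA fun x hx => (hsp hx).1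
  have hdet : IsUnit B.det := (hco.add_smul_one t).isUnit_det (by positivity)
  have hsa : IsSelfAdjoint A := hA
  have hcont (f : ℝ → ℝ) : ContinuousOn f (spectrum ℝ A) :=
    (Matrix.finite_real_spectrum (A := A)).continuousOn f
  have hcfc : cfc (fun x => 1 - (x + t) * (p.eval x * (x ^ s)⁻¹)) A =
      1 - B * (Polynomial.aeval A p * (A ^ s)⁻¹) := by
    rw [cfc_sub (fun _ => 1) _ A (hcont _) (hcont _), cfc_mul _ _ A (hcont _) (hcont _),
      cfc_mul _ _ A (hcont _) (hcont _), cfc_add_const _ _ A (hcont _), cfc_id' ℝ A,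
      cfc_inv (fun x => x ^ s) A (fun x hx => pow_ne_zero _ (ha.trans_le (hsp hx).1).ne')
      (hcont _), cfc_pow_id A s, cfc_polynomial p A, cfc_const_one ℝ A,
      ← Matrix.nonsing_inv_eq_ringInverse, Algebra.algebraMap_eq_smul_one]
    rfl
  have hnorm : ‖1 - B * (Polynomial.aeval A p * (A ^ s)⁻¹)‖ ≤ ε := by
    rw [← hcfc]
    exact norm_cfc_le hε fun x hx => by
      simpa only [div_eq_mul_inv, ← Real.norm_eq_abs] using hp x (hsp hx)
  have hcomm : Polynomial.aeval A p * (A ^ s)⁻¹ = (A ^ s)⁻¹ * Polynomial.aeval A p := by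
    have h1 : Commute (Polynomial.aeval A p) (A ^ s) := by
      rw [← Polynomial.aeval_X_pow (R := ℝ) A]
      exact (Commute.all p (Polynomial.X ^ s)).map (Polynomial.aeval A)
    have hu : IsUnit (A ^ s).det := by
      rw [Matrix.det_pow]
      exact (hco.isUnit_det ha).pow s
    rw [← Matrix.nonsing_inv_mul_cancel_left _ (Polynomial.aeval A p * (A ^ s)⁻¹) hu,
      ← Matrix.mul_assoc (A ^ s), ← h1.eq, Matrix.mul_nonsing_inv_cancel_right _ _ hu]
  refine ⟨((A ^ s)⁻¹ * Polynomial.aeval A p) *ᵥ y, ?_, ?_⟩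
  · refine ⟨_, aeval_mulVec_mem_krylov A y hdeg, ?_⟩
    rw [denomPoly_extendedPoles, map_pow, Polynomial.aeval_X, Matrix.toLin'_apply,
      Matrix.mulVec_mulVec]
  · rw [← hcomm]
    have h1 : B⁻¹ *ᵥ y - (Polynomial.aeval A p * (A ^ s)⁻¹) *ᵥ y =
        B⁻¹ *ᵥ ((1 - B * (Polynomial.aeval A p * (A ^ s)⁻¹)) *ᵥ y) := by
      rw [← Matrix.sub_mulVec, Matrix.mulVec_mulVec, Matrix.mul_sub, Matrix.mul_one,
        Matrix.nonsing_inv_mul_cancel_left _ _ hdet]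
    rw [h1]
    refine (norm_toLp_mulVec_le _ _).trans (mul_le_mul (hco.norm_resolvent_le ha ht) ?_
      (norm_nonneg _) (by positivity))
    refine (norm_toLp_mulVec_le _ _).trans ?_
    rw [hy, mul_one]
    exact hnorm

end ExtendedKrylov

/-! ### Assembly of the error bound -/

section Main

variable {n : ℕ} {A : Matrix (Fin n) (Fin n) ℂ}

lemma Matrix.PosDef.pos_of_mem_spectrum_real (hA : A.PosDef) {x : ℝ} (hx : x ∈ spectrum ℝ A) :
    0 < x := by
  rw [hA.isHermitian.spectrum_real_eq_range_eigenvalues] at hx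
  obtain ⟨i, rfl⟩ := hx
  exact hA.eigenvalues_pos i

/-- Spectral values give b ≤ ‖A‖ and a⁻¹ ≤ ‖A⁻¹‖. Equality for the extreme eigenvalues is not
needed, since the rate increases with the condition number. -/
lemma div_le_condNumber (hA : A.PosDef) {a b : ℝ} (ha : a ∈ spectrum ℝ A)
    (hb : b ∈ spectrum ℝ A) : b / a ≤ condNumber A := by
  have hsa : IsSelfAdjoint A := hA.isHermitian
  have ha0 := hA.pos_of_mem_spectrum_real ha
  have hcont (f : ℝ → ℝ) : ContinuousOn f (spectrum ℝ A) :=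
    (Matrix.finite_real_spectrum (A := A)).continuousOn f
  have h1 := norm_apply_le_norm_cfc (fun x : ℝ => x) A hb (hcont _)
  have h2 := norm_apply_le_norm_cfc (fun x : ℝ => x⁻¹) A ha (hcont _)
  rw [cfc_id' ℝ A] at h1
  rw [cfc_inv (fun x : ℝ => x) A (fun x hx => (hA.pos_of_mem_spectrum_real hx).ne') (hcont _),
    cfc_id' ℝ A, ← Matrix.nonsing_inv_eq_ringInverse] at h2
  rw [condNumber, div_eq_mul_inv]
  exact mul_le_mul ((Real.le_norm_self _).trans h1) ((Real.le_norm_self _).trans h2)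
    (by positivity) (norm_nonneg _)

lemma norm_le_of_spectrum_subset (hA : A.IsHermitian) {a b : ℝ} (ha : 0 < a) (hab : a ≤ b)
    (hsp : spectrum ℝ A ⊆ Set.Icc a b) : ‖A‖ ≤ b := by
  have hsa : IsSelfAdjoint A := hA
  rw [← cfc_id' ℝ A]
  refine norm_cfc_le (ha.le.trans hab) fun x hx => ?_
  rw [Real.norm_of_nonneg (ha.le.trans (hsp hx).1)]
  exact (hsp hx).2

/-- The error of a two-sided product approximation `G E G'` of `R E R` for a rank-one `E`. -/
lemma norm_mul_vecMulVec_mul_sub_le {R G G' : Matrix (Fin n) (Fin n) ℂ} (hR : R.IsHermitian)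
    (hG' : G'.IsHermitian) {y z : Fin n → ℂ} {r δ : ℝ} (hr : 0 ≤ r) (hRr : ‖R‖ ≤ r)
    (hGr : ‖G‖ ≤ r) (hy : ‖(WithLp.toLp 2 y : EuclideanSpace ℂ (Fin n))‖ = 1)
    (hz : ‖(WithLp.toLp 2 z : EuclideanSpace ℂ (Fin n))‖ = 1)
    (h1 : ‖WithLp.toLp 2 ((R - G) *ᵥ y)‖ ≤ δ) (h2 : ‖WithLp.toLp 2 ((R - G') *ᵥ z)‖ ≤ δ) (η : ℂ) :
    ‖R * (η • vecMulVec y (star z)) * R - G * (η • vecMulVec y (star z)) * G'‖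
      ≤ ‖η‖ * (2 * δ * r) := by
  -- Telescoping RER - GEG' = (R - G)ER + GE(R - G'); since R - G' is Hermitian, zᴴ(R - G') = ((R -
  -- G')z)ᴴ.
  have hsplit : R * (η • vecMulVec y (star z)) * R - G * (η • vecMulVec y (star z)) * G' =
      η • (vecMulVec ((R - G) *ᵥ y) (star z) * R +
        G * vecMulVec y (star ((R - G') *ᵥ z))) := by
    rw [Matrix.star_mulVec, (hR.sub hG').eq, ← Matrix.vecMulVec_mul, ← Matrix.mul_vecMulVec]
    simp only [Matrix.mul_smul, Matrix.smul_mul, ← smul_sub]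
    congr 1
    noncomm_ring
  rw [hsplit, norm_smul]
  have h3 : ‖vecMulVec ((R - G) *ᵥ y) (star z)‖ ≤ δ := by
    refine (norm_vecMulVec_le _ _).trans ?_
    rwa [hz, mul_one]
  have h4 : ‖vecMulVec y (star ((R - G') *ᵥ z))‖ ≤ δ := by
    refine (norm_vecMulVec_le _ _).trans ?_
    rwa [hy, one_mul]
  have hδ : 0 ≤ δ := (norm_nonneg _).trans h3
  gcongr
  calc _ ≤ ‖vecMulVec ((R - G) *ᵥ y) (star z)‖ * ‖R‖ +
        ‖G‖ * ‖vecMulVec y (star ((R - G') *ᵥ z))‖ :=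
        (norm_add_le _ _).trans (add_le_add (norm_mul_le _ _) (norm_mul_le _ _))
    _ ≤ δ * r + r * δ := by gcongr
    _ = _ := by ring

lemma isHermitian_resolvent (hA : A.IsHermitian) (t : ℝ) :
    (A + (t : ℂ) • (1 : Matrix (Fin n) (Fin n) ℂ))⁻¹.IsHermitian := by
  refine (hA.add ?_).inv
  rw [Matrix.IsHermitian, conjTranspose_smul, conjTranspose_one]
  simp

/-- Reduction of the error of the extended Krylov approximation to scalar approximation of
`(x + t)⁻¹`. -/
lemma norm_stieltjesFrechet_sub_krylovFrechetApprox_le (hA : A.IsHermitian) {a b : ℝ}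
    (ha : 0 < a) (hab : a ≤ b) (hsp : spectrum ℝ A ⊆ Set.Icc a b) {ν : Measure ℝ}
    (hν : IntegrableOn (fun t : ℝ => 1 / (1 + t)) (Set.Ici 0) ν) (η : ℂ) {y z : Fin n → ℂ}
    (hy : ‖(WithLp.toLp 2 y : EuclideanSpace ℂ (Fin n))‖ = 1)
    (hz : ‖(WithLp.toLp 2 z : EuclideanSpace ℂ (Fin n))‖ = 1) {m k l : ℕ}
    {V : Matrix (Fin n) (Fin k) ℂ} {W : Matrix (Fin n) (Fin l) ℂ}
    (hV : IsOrthonormalBasisOf V (rationalKrylov A y extendedPoles m))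
    (hW : IsOrthonormalBasisOf W (rationalKrylov A z extendedPoles m)) {ε : ℝ} (hε : 0 ≤ ε)
    (happ : ∀ t : ℝ, 0 ≤ t → ∃ p : Polynomial ℝ, p.natDegree < m ∧ ∀ x ∈ Set.Icc a b,
      |1 - (x + t) * (p.eval x / x ^ ((m - 1) / 2))| ≤ ε) :
    ‖stieltjesFrechet ν A (η • vecMulVec y (star z)) - krylovFrechetApprox ν A η y z V W‖
      ≤ ‖η‖ * stieltjesFun ν a * (2 * (1 + b / a) / a) * ε := by
  have hco : IsCoerciveWith a A := .of_isHermitian hA fun x hx => (hsp hx).1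
  have hnorm := norm_le_of_spectrum_subset hA ha hab hsp
  obtain ⟨hint, heq⟩ := integrableOn_galerkin_and_krylovFrechetApprox_eq hco ha hν hV.1 hW.1 η y z
  have hint' := integrableOn_resolvent_mul_mul_resolvent hco hco ha hν (η • vecMulVec y (star z))
  have hba : 0 ≤ 1 + b / a := by
    have := div_nonneg (ha.le.trans hab) ha.le
    linarith
  rw [hco.stieltjesFrechet_eq ha hν, heq, sub_neg_eq_add,
    ← integral_add (by simp only [resolventFDeriv_apply]; exact hint'.neg) hint]
  have hpt : ∀ t ∈ Set.Ici (0 : ℝ), ‖resolventFDeriv A t (η • vecMulVec y (star z)) +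
      galerkinResolvent A V t * (η • vecMulVec y (star z)) * galerkinResolvent A W t‖ ≤
      ‖η‖ * (2 * (1 + b / a) / a) * ε * (a + t)⁻¹ := by
    intro t ht
    have ht0 : 0 ≤ t := ht
    obtain ⟨p, hdeg, hp⟩ := happ t ht
    obtain ⟨v, hv, hvle⟩ := exists_mem_rationalKrylov_norm_sub_le hA ha hsp y hy ht hdeg hε hp
    obtain ⟨w, hw, hwle⟩ := exists_mem_rationalKrylov_norm_sub_le hA ha hsp z hz ht hdeg hε hp
    have h1 := (norm_resolvent_sub_galerkinResolvent_mulVec_le hco ha hnorm hab hV ht y v hv).trans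
      (mul_le_mul_of_nonneg_left hvle hba)
    have h2 := (norm_resolvent_sub_galerkinResolvent_mulVec_le hco ha hnorm hab hW ht z w hw).trans
      (mul_le_mul_of_nonneg_left hwle hba)
    -- Only one of the two resolvent factors is estimated away; the other must remain to integrate
    -- to f(a).
    have hat : (a + t)⁻¹ ≤ a⁻¹ := by
      gcongr
      linarith
    rw [resolventFDeriv_apply, neg_add_eq_sub, norm_sub_rev]
    refine (norm_mul_vecMulVec_mul_sub_le (isHermitian_resolvent hA t)
      (isHermitian_galerkinResolvent hA t) (by positivity) (hco.norm_resolvent_le ha ht)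
      (norm_galerkinResolvent_le hco ha hV.1 ht) hy hz h1 h2 η).trans ?_
    calc _ = ‖η‖ * (2 * (1 + b / a)) * ε * (a + t)⁻¹ * (a + t)⁻¹ := by ring
      _ ≤ ‖η‖ * (2 * (1 + b / a)) * ε * (a + t)⁻¹ * a⁻¹ := by gcongr
      _ = _ := by ring
  refine (norm_integral_le_of_norm_le ((integrableOn_inv_add hν ha).const_mul _)
    ((ae_restrict_iff' measurableSet_Ici).mpr (.of_forall hpt))).trans (le_of_eq ?_)
  rw [integral_const_mul, stieltjesFun]
  ring

lemma stieltjesFun_nonneg (ν : Measure ℝ) {x : ℝ} (hx : 0 ≤ x) : 0 ≤ stieltjesFun ν x :=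
  setIntegral_nonneg measurableSet_Ici fun _ ht => inv_nonneg.mpr (add_nonneg hx ht)

end Main

theorem mainTheorem3 (lmin lmax : ℝ) :
    ∃ C : ℝ, 0 < C ∧
      ∀ (n : ℕ) (A : Matrix (Fin n) (Fin n) ℂ), A.PosDef →
        IsLeast (spectrum ℝ A) lmin → IsGreatest (spectrum ℝ A) lmax →
      ∀ (μ : ℝ≥0 → ℝ) (_ : ∀ t, 0 ≤ μ t) (hμ : Monotone μ),
        IntegrableOn (fun t : ℝ => 1 / (1 + t)) (Set.Ici 0) (stieltjesMeasure μ hμ) →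
      DifferentiableAt ℂ (stieltjesMatrixFun (ι := Fin n) (stieltjesMeasure μ hμ)) A ∧
      ∀ (η : ℂ) (y z : Fin n → ℂ), ‖(WithLp.toLp 2 y : EuclideanSpace ℂ (Fin n))‖ = 1 →
        ‖(WithLp.toLp 2 z : EuclideanSpace ℂ (Fin n))‖ = 1 →
      ∀ m : ℕ, 1 ≤ m →
      ∀ (k l : ℕ) (V : Matrix (Fin n) (Fin k) ℂ) (W : Matrix (Fin n) (Fin l) ℂ),
        IsOrthonormalBasisOf V (rationalKrylov A y extendedPoles m) →
        IsOrthonormalBasisOf W (rationalKrylov A z extendedPoles m) →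
        ‖stieltjesFrechet (stieltjesMeasure μ hμ) A (η • vecMulVec y (star z))
            - krylovFrechetApprox (stieltjesMeasure μ hμ) A η y z V W‖
          ≤ ‖η‖ * stieltjesFun (stieltjesMeasure μ hμ) lmin * C *
            ((condNumber A ^ (1 / 4 : ℝ) - 1) / (condNumber A ^ (1 / 4 : ℝ) + 1)) ^ m := by
  -- Positive definiteness and the extremal conditions force these inequalities, so otherwise no A
  -- is admissible and any constant works.
  by_cases hl : 0 < lmin ∧ lmin ≤ lmax
  swap
  · refine ⟨1, one_pos, fun n A hA hmin hmax => absurd ?_ hl⟩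
    exact ⟨hA.pos_of_mem_spectrum_real hmin.1, hmin.2 hmax.1⟩
  obtain ⟨ha, hab⟩ := hl
  obtain ⟨K, hK, happ⟩ := exists_extended_approx ha hab
  have hlmax : 0 < lmax := ha.trans_le hab
  have hratio : 1 ≤ lmax / lmin := (one_le_div ha).mpr hab
  refine ⟨2 * (1 + lmax / lmin) / lmin * K, by positivity, ?_⟩
  intro n A hA hmin hmax μ _ hμ hν
  have hsp : spectrum ℝ A ⊆ Set.Icc lmin lmax := fun x hx => ⟨hmin.2 hx, hmax.2 hx⟩
  have hco : IsCoerciveWith lmin A := .of_isHermitian hA.isHermitian fun x hx => hmin.2 hx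
  refine ⟨(hco.hasFDerivAt_stieltjesMatrixFun ha hν).differentiableAt, ?_⟩
  intro η y z hy hz m hm k l V W hV hW
  have hρ := extendedRate_nonneg hratio
  refine (norm_stieltjesFrechet_sub_krylovFrechetApprox_le hA.isHermitian ha hab hsp hν η hy hz
    hV hW (by positivity) (happ m hm)).trans ?_
  have hf := stieltjesFun_nonneg (stieltjesMeasure μ hμ) ha.le
  rw [← extendedRate]
  calc _ = ‖η‖ * stieltjesFun (stieltjesMeasure μ hμ) lmin *
        (2 * (1 + lmax / lmin) / lmin * K) * extendedRate (lmax / lmin) ^ m := by ring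
    _ ≤ _ := by
      gcongr
      exact extendedRate_mono hratio (div_le_condNumber hA hmin.1 hmax.1)
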